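/- Let $(f_n)_{n\ge 0}$ be a sequence of real polynomials of binomial type, i.e. $f_n(x+y)=\sum_{j=0}^{n}\binom nj f_j(x)f_{n-j}(y)$ for all $n\ge 0$ and all real $x,y$, with $f_0=1$, and let $a,x,\alpha$ be real numbers. Since $f_n(0)=0$ for $n\ge 1$, the expression $f_n(y;a):=\frac{y}{an+y}f_n(an+y)$, with $f_0(y;a)=1$, is a polynomial in $y$. Let $B_{n,k}(x_1,x_2,\dots)$ denote the partial exponential Bell polynomials, defined by $\sum_{n\ge k}B_{n,k}(x_1,x_2,\dots)\frac{t^n}{n!}=\frac1{k!}\Bigl(\sum_{m\ge1}x_m\frac{t^m}{m!}\Bigr)^k$. Say that an array of real numbers $(Y(n,k))_{n\ge k\ge 1}$ satisfies (H) if $$B_{n,k}\bigl(Y(1,1),Y(2,1),Y(3,1),\dots\bigr)=Y(n,k)\qquad\text{for all integers } n\ge k\ge 1 .$$ (i) Let $r,s\ge 0$ be integers with $r+s\ge 1$ and put $T=T(n,k)=r(n-k)+sk$; where $T=0$ (that is, $s=0$ and $n=k$), the quotient $\frac{sk}{T}$ is read as $1$, its value for $n=k$ and any $s\geq 1$. Then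 the array $$Y(n,k)=\binom nk\frac{sk}{T}\,D_{z=0}^{T}\bigl(e^{\alpha z}f_{n-k}(Tx+z;a)\bigr)$$ satisfies (H). For $\alpha=0$ it may be replaced by another array: the array $$Y(n,k)=\frac{n!}{k!\,(T+n-k)!}\,\frac{sk}{T}\,D_{z=0}^{T}f_{T+n-k}(Tx+z;a)$$ also satisfies (H). Here $D_{z=0}^{T}$ is the $T$-th derivative with respect to $z$, evaluated at $z=0$. (ii) For $r=s=0$, the array $Y(n,k)=\binom nk f_{n-k}(kx;a)$ satisfies (H). -/

import Mathlib

open Polynomial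
open scoped Nat

/-- A sequence of real polynomials is of binomial type:
`f n (x + y) = ∑ j ≤ n, C(n, j) * f j x * f (n - j) y`. -/
def IsBinomialType (f : ℕ → ℝ[X]) : Prop :=
  ∀ (n : ℕ) (x y : ℝ),
    (f n).eval (x + y) =
      ∑ j ∈ Finset.range (n + 1), (n.choose j : ℝ) * (f j).eval x * (f (n - j)).eval y

/-- The polynomial `f n (x; a) = x / (a n + x) * f n (a n + x)` in `x`, with `f 0 (x; a) = 1`.
For `1 ≤ n` a sequence of binomial type with `f 0 = 1` satisfies `f n 0 = 0`, so that
`f n (y) / y` is the polynomial `(f n).divX`; the value of `f n (x; a)` where `a n + x = 0`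
is the one of this polynomial. -/
noncomputable def shifted (f : ℕ → ℝ[X]) (a : ℝ) (n : ℕ) : ℝ[X] :=
  if n = 0 then 1 else X * (f n).divX.comp (X + C (a * n))

theorem IsBinomialType.eval_zero {f : ℕ → ℝ[X]} (hf : IsBinomialType f) (hf0 : f 0 = 1)
    {n : ℕ} (hn : n ≠ 0) : (f n).eval 0 = 0 := by
  induction n using Nat.strong_induction_on with
  | _ n ih =>
    have h := hf n 0 0
    obtain ⟨m, rfl⟩ := Nat.exists_eq_succ_of_ne_zero hn
    rw [Finset.sum_range_succ, Finset.sum_eq_single_of_mem 0 (by simp)] at h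
    · simp [hf0] at h
      linarith
    · intro j hj hj0
      rw [ih j (by simpa using hj) hj0]
      simp

/-- The defining formula of `f n (x; a)` wherever its denominator does not vanish. -/
theorem shifted_eval {f : ℕ → ℝ[X]} (hf : IsBinomialType f) (hf0 : f 0 = 1) (a x : ℝ) (n : ℕ)
    (h : a * n + x ≠ 0) :
    (shifted f a n).eval x = x / (a * n + x) * (f n).eval (a * n + x) := by
  unfold shifted
  split_ifs with hn
  · subst hn
    simp at h
    simp [hf0, h]
  · have h1 := congrArg (eval (a * n + x)) (divX_mul_X_add (f n))
    rw [coeff_zero_eq_eval_zero, hf.eval_zero hf0 hn] at h1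
    simp only [map_zero, add_zero, eval_mul, eval_X] at h1
    rw [← h1]
    simp only [eval_mul, eval_X, eval_comp, eval_add, eval_C]
    rw [add_comm x]
    field_simp

/-- The partial exponential Bell polynomial `B_{n,k} (x 1, x 2, …)`, given by
`∑ n, B_{n,k} t ^ n / n! = (∑ m ≥ 1, x m * t ^ m / m!) ^ k / k!`. The entry `x 0` is not used. -/
noncomputable def partialBell (x : ℕ → ℝ) (n k : ℕ) : ℝ :=
  n ! * PowerSeries.coeff n
    (PowerSeries.C (1 / (k ! : ℝ)) *
      (PowerSeries.mk fun m => if m = 0 then 0 else x m / (m ! : ℝ)) ^ k)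

/-- The equation `B_{n,k} (Y(1,1), Y(2,1), …) = Y(n,k)` for all `n ≥ k ≥ 1`. -/
def SatisfiesBell (Y : ℕ → ℕ → ℝ) : Prop :=
  ∀ n k : ℕ, 1 ≤ k → k ≤ n → partialBell (fun m => Y m 1) n k = Y n k

/-- `T = r (n - k) + s k`, used for `k ≤ n` only. -/
def bellT (r s n k : ℕ) : ℕ := r * (n - k) + s * k

/-- The factor `s k / T`. For `r + s ≥ 1` and `n ≥ k ≥ 1` the quotient is `0 / 0` only if
`s = 0` and `n = k`; there it is given the value `1` that it has for `n = k` and every `s ≥ 1`. -/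
noncomputable def bellRatio (r s n k : ℕ) : ℝ :=
  if bellT r s n k = 0 then 1 else (s * k : ℝ) / (bellT r s n k : ℝ)

/-- `Y(n,k) = C(n,k) * (s k / T) * D_{z=0}^T (exp (α z) * f_{n-k} (T x + z; a))`. -/
noncomputable def bellY (f : ℕ → ℝ[X]) (a x α : ℝ) (r s n k : ℕ) : ℝ :=
  (n.choose k : ℝ) * bellRatio r s n k *
    iteratedDeriv (bellT r s n k)
      (fun z : ℝ => Real.exp (α * z) * (shifted f a (n - k)).eval (bellT r s n k * x + z)) 0

/-- `Y(n,k) = n! / (k! (T + n - k)!) * (s k / T) * D_{z=0}^T f_{T+n-k} (T x + z; a)`. -/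
noncomputable def bellYAlt (f : ℕ → ℝ[X]) (a x : ℝ) (r s n k : ℕ) : ℝ :=
  (n ! : ℝ) / ((k ! : ℝ) * ((bellT r s n k + (n - k)) ! : ℝ)) * bellRatio r s n k *
    iteratedDeriv (bellT r s n k)
      (fun z : ℝ => (shifted f a (bellT r s n k + (n - k))).eval (bellT r s n k * x + z)) 0

/-- `Y(n,k) = C(n,k) * f_{n-k} (k x; a)`, the sequence for `r = s = 0`. -/
noncomputable def bellYZero (f : ℕ → ℝ[X]) (a x : ℝ) (n k : ℕ) : ℝ :=
  (n.choose k : ℝ) * (shifted f a (n - k)).eval (k * x)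

/-! A sequence of binomial type has a generating function E(y) = exp(y h(t)). Lagrange inversion
expands E(x) in powers of t E(-a), and since E(x + y) = E(x) E(y), the coefficients of these
expansions convolve (`IsPowerFamily.lagrangeCoeff_add`). This is used twice. Over ℝ the coefficients
are f_n(x; a) / n!, so the shifted sequence is again of binomial type. Let Q(y) = exp(y h) now be
its generating function. Each d/dz multiplies e^{αz} Q(w + z) by α + h, and Q(Tx) = Q(x)^T, so
Y(n,k) = n!/k! · sk/T · [t^{n-k}] u^T with u = (α + h) Q(x). Over ℤ, for the powers of u, inversion
turns sk/T · [t^{n-k}] u^T into [t^{n-k}] v^{sk}, where v = u(t v^r) (`fussSeries_pow`). An array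
n!/k! · [t^{n-k}] V^k satisfies (H) directly; here V = v^s, or V = Q(x) when r = s = 0. -/

/-! ### Lagrange inversion for power families -/

/-- A family of power series that is multiplicative in its exponent, with logarithmic
derivatives proportional to the exponent, such as `w ↦ exp (w * h)`. -/
structure IsPowerFamily {A : Type*} [AddCommGroup A] (ι : A →+ ℝ) (H : PowerSeries ℝ)
    (E : A → PowerSeries ℝ) : Prop where
  apply_zero : E 0 = 1
  apply_add : ∀ v w, E (v + w) = E v * E w
  derivative : ∀ w, PowerSeries.derivative ℝ (E w) = PowerSeries.C (ι w) * H * E w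

/-- The coefficients of `E x` in the powers of `X * E (-a)`. -/
noncomputable def lagrangeCoeff {A : Type*} [AddCommGroup A] (ι : A →+ ℝ) (H : PowerSeries ℝ)
    (E : A → PowerSeries ℝ) (a : A) (n : ℕ) (x : A) : ℝ :=
  if n = 0 then PowerSeries.coeff 0 (E x)
  else ι x / n * PowerSeries.coeff n (PowerSeries.X * H * E (x + n • a))

theorem PowerSeries.coeff_X_mul_derivative (F : PowerSeries ℝ) (n : ℕ) :
    PowerSeries.coeff n (PowerSeries.X * PowerSeries.derivative ℝ F) =
      n * PowerSeries.coeff n F := by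
  cases n with
  | zero => simp
  | succ n => rw [PowerSeries.coeff_succ_X_mul, PowerSeries.coeff_derivative]; push_cast; ring

namespace IsPowerFamily

variable {A : Type*} [AddCommGroup A] {ι : A →+ ℝ} {H : PowerSeries ℝ}
  {E : A → PowerSeries ℝ}

theorem mul_coeff (h : IsPowerFamily ι H E) (w : A) (n : ℕ) :
    n * PowerSeries.coeff n (E w) =
      ι w * PowerSeries.coeff n (PowerSeries.X * H * E w) := by
  rw [← PowerSeries.coeff_X_mul_derivative, h.derivative, ← PowerSeries.coeff_C_mul]
  congr 1
  ring

theorem mul_neg (h : IsPowerFamily ι H E) (w : A) : E w * E (-w) = 1 := by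
  rw [← h.apply_add, add_neg_cancel, h.apply_zero]

theorem mul_lagrangeCoeff (a x : A) (n : ℕ) :
    n * lagrangeCoeff ι H E a n x =
      ι x * PowerSeries.coeff n (PowerSeries.X * H * E (x + n • a)) := by
  unfold lagrangeCoeff
  split_ifs with hn
  · subst hn
    simp [mul_assoc]
  · field_simp

/-- With φ = t E(-a) this is the residue of (φ^k)' φ^{-n}, which vanishes for k ≠ n because the
series is k/(k-n) times the derivative of φ^{k-n}. -/
theorem coeff_X_mul_derivative_sub (h : IsPowerFamily ι H E) (a : A) {k n : ℕ} (hk : k < n) :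
    PowerSeries.coeff n (PowerSeries.X *
      PowerSeries.derivative ℝ (PowerSeries.X ^ k * E (-(k • a))) * E (n • a)) = 0 := by
  obtain ⟨m, rfl⟩ := Nat.exists_eq_add_of_lt hk
  set M := m + 1 with hM
  have hE : E (-(k • a)) * E ((k + m + 1) • a) = E (M • a) := by
    rw [← h.apply_add, add_assoc, add_smul]
    congr 1
    abel
  have h1 : PowerSeries.X * PowerSeries.derivative ℝ (PowerSeries.X ^ k * E (-(k • a))) *
      E ((k + m + 1) • a) = PowerSeries.X ^ k * (PowerSeries.C (k : ℝ) * E (M • a) -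
        PowerSeries.C (k * ι a) * (PowerSeries.X * H * E (M • a))) := by
    have hX : PowerSeries.X * PowerSeries.derivative ℝ (PowerSeries.X ^ k : PowerSeries ℝ) =
        PowerSeries.X ^ k * PowerSeries.C (k : ℝ) := by
      rw [Derivation.leibniz_pow, PowerSeries.derivative_X]
      cases k with
      | zero => simp
      | succ k => simp [pow_succ]; ring
    rw [Derivation.leibniz, h.derivative, ← hE]
    simp only [smul_eq_mul, mul_add, map_neg, map_nsmul, nsmul_eq_mul, map_mul]
    linear_combination (E (-(k • a)) * E ((k + m + 1) • a)) * hX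
  rw [h1, add_assoc, add_comm, PowerSeries.coeff_X_pow_mul, map_sub, PowerSeries.coeff_C_mul,
    PowerSeries.coeff_C_mul]
  have h2 := h.mul_coeff (M • a) M
  have hM0 : (M : ℝ) ≠ 0 := by positivity
  rw [map_nsmul, nsmul_eq_mul, mul_assoc] at h2
  rw [mul_left_cancel₀ hM0 h2]
  ring

theorem X_pow_dvd_sub (h : IsPowerFamily ι H E) (a x : A) (n : ℕ) :
    PowerSeries.X ^ n ∣ E x - ∑ k ∈ Finset.range n,
      PowerSeries.C (lagrangeCoeff ι H E a k x) * (PowerSeries.X ^ k * E (-(k • a))) := by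
  induction n with
  | zero => simp
  | succ n ih =>
    obtain ⟨R, hR⟩ := ih
    rw [Finset.sum_range_succ, ← sub_sub, hR, pow_succ, mul_left_comm, ← mul_sub]
    apply mul_dvd_mul_left
    rw [PowerSeries.X_dvd_iff]
    have hc : PowerSeries.constantCoeff (E (n • a)) *
        PowerSeries.constantCoeff (E (-(n • a))) = 1 := by
      rw [← map_mul, h.mul_neg, map_one]
    rcases Nat.eq_zero_or_pos n with rfl | hn
    · simp [lagrangeCoeff, h.apply_zero] at hR ⊢
      simp [hR]
    -- The functional F ↦ [t^n] t F' E(na) kills the terms with k < n; its values on t^n R and on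
    -- E(x) determine the constant term of R.
    · have h1 : PowerSeries.coeff n (PowerSeries.X *
          PowerSeries.derivative ℝ (PowerSeries.X ^ n * R) * E (n • a)) =
          n * (PowerSeries.constantCoeff R * PowerSeries.constantCoeff (E (n • a))) := by
        have : PowerSeries.X *
          PowerSeries.derivative ℝ (PowerSeries.X ^ n * R) * E (n • a) =
          PowerSeries.X ^ n * ((PowerSeries.X * PowerSeries.derivative ℝ R +
            PowerSeries.C (n : ℝ) * R) * E (n • a)) := by
          obtain ⟨n, rfl⟩ := Nat.exists_eq_succ_of_ne_zero hn.ne'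
          rw [Derivation.leibniz, Derivation.leibniz_pow, PowerSeries.derivative_X]
          simp [pow_succ]
          ring
        rw [this, PowerSeries.coeff_X_pow_mul' , if_pos le_rfl]
        simp [mul_assoc]
      have h2 : PowerSeries.coeff n (PowerSeries.X *
          PowerSeries.derivative ℝ (PowerSeries.X ^ n * R) * E (n • a)) =
          n * lagrangeCoeff ι H E a n x := by
        rw [← hR, mul_lagrangeCoeff, map_sub, map_sum, mul_sub, sub_mul, map_sub,
          Finset.mul_sum, Finset.sum_mul, map_sum, Finset.sum_eq_zero, sub_zero, h.derivative,
          h.apply_add, ← PowerSeries.coeff_C_mul]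
        · congr 1
          ring
        · intro k hk
          have h3 := h.coeff_X_mul_derivative_sub a (Finset.mem_range.1 hk)
          rw [← PowerSeries.smul_eq_C_mul, Derivation.map_smul, mul_smul_comm, smul_mul_assoc,
            map_smul, h3, smul_zero]
      rw [h1] at h2
      have h4 := mul_left_cancel₀ (Nat.cast_ne_zero.2 hn.ne') h2
      simp only [map_sub, map_mul, PowerSeries.constantCoeff_C]
      rw [← h4]
      linear_combination (-PowerSeries.constantCoeff R) * hc

theorem coeff_mul_eq_sum (h : IsPowerFamily ι H E) (a x : A) (S : PowerSeries ℝ) (n : ℕ) :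
    PowerSeries.coeff n (S * E x) = ∑ k ∈ Finset.range (n + 1),
      lagrangeCoeff ι H E a k x * PowerSeries.coeff (n - k) (S * E (-(k • a))) := by
  obtain ⟨R, hR⟩ := h.X_pow_dvd_sub a x (n + 1)
  rw [sub_eq_iff_eq_add] at hR
  rw [hR, mul_add, map_add, mul_left_comm, PowerSeries.coeff_X_pow_mul', if_neg (by simp),
    zero_add, Finset.mul_sum, map_sum]
  refine Finset.sum_congr rfl fun k hk => ?_
  rw [mul_left_comm, PowerSeries.coeff_C_mul, mul_left_comm, PowerSeries.coeff_X_pow_mul',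
    if_pos (Nat.lt_succ_iff.1 (Finset.mem_range.1 hk))]

theorem lagrangeCoeff_add (h : IsPowerFamily ι H E) (a x y : A) (n : ℕ) :
    lagrangeCoeff ι H E a n (x + y) = ∑ k ∈ Finset.range (n + 1),
      lagrangeCoeff ι H E a k x * lagrangeCoeff ι H E a (n - k) y := by
  -- Expanding E(x) alone gives the convolution weighted by n - k. Exchanging x and y gives the
  -- weight k, and the two add up to the factor n.
  have key : ∀ x y : A, ι y * PowerSeries.coeff n (PowerSeries.X * H * E (x + y + n • a)) =
      ∑ k ∈ Finset.range (n + 1), lagrangeCoeff ι H E a k x *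
        ((n - k : ℕ) * lagrangeCoeff ι H E a (n - k) y) := by
    intro x y
    have : PowerSeries.X * H * E (x + y + n • a) =
        (PowerSeries.X * H * E (y + n • a)) * E x := by
      rw [mul_assoc _ (E _), ← h.apply_add]
      congr 2
      abel
    rw [this, h.coeff_mul_eq_sum a x, Finset.mul_sum]
    refine Finset.sum_congr rfl fun k hk => ?_
    have hE : E (y + n • a) * E (-(k • a)) = E (y + (n - k) • a) := by
      obtain ⟨m, rfl⟩ := Nat.exists_eq_add_of_le (Nat.lt_succ_iff.1 (Finset.mem_range.1 hk))
      rw [← h.apply_add, add_smul, Nat.add_sub_cancel_left]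
      congr 1
      abel
    rw [mul_lagrangeCoeff, mul_assoc _ (E _), hE, mul_left_comm]
  rcases Nat.eq_zero_or_pos n with rfl | hn
  · simp [lagrangeCoeff, h.apply_add]
  · apply mul_left_cancel₀ (Nat.cast_ne_zero (R := ℝ).2 hn.ne')
    have h2 := key y x
    rw [← Finset.sum_range_reflect, add_comm y x] at h2
    rw [mul_lagrangeCoeff, map_add, add_mul, key x y, h2, ← Finset.sum_add_distrib,
      Finset.mul_sum]
    refine Finset.sum_congr rfl fun k hk => ?_
    have hk' := Nat.lt_succ_iff.1 (Finset.mem_range.1 hk)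
    rw [show n + 1 - 1 - k = n - k by omega, show n - (n - k) = k by omega, Nat.cast_sub hk']
    ring

end IsPowerFamily

/-! ### Generating functions of sequences of binomial type -/

/-- The exponential generating function of `n ↦ f n y`. -/
noncomputable def egf (f : ℕ → ℝ[X]) (y : ℝ) : PowerSeries ℝ :=
  PowerSeries.mk fun n => (f n).eval y / (n ! : ℝ)

theorem factorial_mul_coeff_egf (f : ℕ → ℝ[X]) (y : ℝ) (n : ℕ) :
    n ! * PowerSeries.coeff n (egf f y) = (f n).eval y := by
  rw [egf, PowerSeries.coeff_mk]
  field_simp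

theorem factorial_mul_coeff_egf_mul (f : ℕ → ℝ[X]) (x y : ℝ) (n : ℕ) :
    n ! * PowerSeries.coeff n (egf f x * egf f y) =
      ∑ j ∈ Finset.range (n + 1), (n.choose j : ℝ) * (f j).eval x * (f (n - j)).eval y := by
  rw [PowerSeries.coeff_mul, Finset.Nat.sum_antidiagonal_eq_sum_range_succ_mk, Finset.mul_sum]
  refine Finset.sum_congr rfl fun j hj => ?_
  rw [Nat.cast_choose ℝ (Nat.lt_succ_iff.1 (Finset.mem_range.1 hj))]
  simp only [egf, PowerSeries.coeff_mk]
  field_simp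

theorem isBinomialType_iff {f : ℕ → ℝ[X]} :
    IsBinomialType f ↔ ∀ x y, egf f (x + y) = egf f x * egf f y := by
  constructor
  · intro hf x y
    ext n
    apply mul_left_cancel₀ (Nat.cast_ne_zero (R := ℝ).2 n.factorial_ne_zero)
    rw [factorial_mul_coeff_egf, factorial_mul_coeff_egf_mul, hf]
  · intro h n x y
    rw [← factorial_mul_coeff_egf, ← factorial_mul_coeff_egf_mul, h]

theorem continuous_coeff_egf (f : ℕ → ℝ[X]) (n : ℕ) :
    Continuous fun y => PowerSeries.coeff n (egf f y) := by
  simp only [egf, PowerSeries.coeff_mk]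
  fun_prop

theorem continuous_coeff_mul {P R : ℝ → PowerSeries ℝ}
    (hP : ∀ n, Continuous fun y => PowerSeries.coeff n (P y))
    (hR : ∀ n, Continuous fun y => PowerSeries.coeff n (R y)) (n : ℕ) :
    Continuous fun y => PowerSeries.coeff n (P y * R y) := by
  simp only [PowerSeries.coeff_mul]
  exact continuous_finsetSum _ fun p _ => (hP _).mul (hR _)

theorem IsBinomialType.egf_zero {f : ℕ → ℝ[X]} (hf : IsBinomialType f) (hf0 : f 0 = 1) :
    egf f 0 = 1 := by
  ext n
  rcases eq_or_ne n 0 with rfl | hn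
  · simp [egf, hf0]
  · simp [egf, hf.eval_zero hf0 hn, PowerSeries.coeff_one, hn]

/-- The logarithmic derivative L(y) is additive in y with continuous coefficients, hence linear, so
H = L(1). -/
theorem IsBinomialType.exists_isPowerFamily {f : ℕ → ℝ[X]} (hf : IsBinomialType f)
    (hf0 : f 0 = 1) : ∃ H, IsPowerFamily (AddMonoidHom.id ℝ) H (egf f) := by
  have hadd := isBinomialType_iff.1 hf
  have hinv : ∀ y, egf f y * egf f (-y) = 1 := fun y => by
    rw [← hadd, add_neg_cancel, hf.egf_zero hf0]
  set L : ℝ → PowerSeries ℝ := fun y => PowerSeries.derivative ℝ (egf f y) * egf f (-y) with hL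
  have hLadd : ∀ x y, L (x + y) = L x + L y := by
    intro x y
    simp only [hL]
    rw [neg_add, hadd, hadd, Derivation.leibniz, smul_eq_mul, smul_eq_mul]
    linear_combination (PowerSeries.derivative ℝ (egf f y) * egf f (-y)) * hinv x +
      (PowerSeries.derivative ℝ (egf f x) * egf f (-x)) * hinv y
  have hcont : ∀ n, Continuous fun y => PowerSeries.coeff n (L y) := by
    apply continuous_coeff_mul
    · intro n
      simp only [PowerSeries.coeff_derivative]
      exact (continuous_coeff_egf f _).mul continuous_const
    · exact fun n => (continuous_coeff_egf f n).comp continuous_neg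
  have hlin : ∀ y, L y = PowerSeries.C y * L 1 := by
    intro y
    ext n
    have := map_real_smul (AddMonoidHom.mk' (fun y => PowerSeries.coeff n (L y))
      fun x y => by rw [hLadd, map_add]) (hcont n) y 1
    simpa using this
  refine ⟨L 1, hf.egf_zero hf0, hadd, fun w => ?_⟩
  rw [AddMonoidHom.id_apply, ← hlin]
  linear_combination (-PowerSeries.derivative ℝ (egf f w)) * hinv w

theorem IsPowerFamily.eval_divX {f : ℕ → ℝ[X]} {H : PowerSeries ℝ}
    (h : IsPowerFamily (AddMonoidHom.id ℝ) H (egf f)) {n : ℕ} (hn : n ≠ 0) (w : ℝ) :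
    (f n).divX.eval w = n ! / n * PowerSeries.coeff n (PowerSeries.X * H * egf f w) := by
  have hcont : Continuous fun w =>
      (n ! / n : ℝ) * PowerSeries.coeff n (PowerSeries.X * H * egf f w) :=
    continuous_const.mul (continuous_coeff_mul (fun _ => continuous_const)
      (continuous_coeff_egf f) n)
  -- Away from 0 one may divide by the argument; continuity then gives the value at 0.
  refine congrFun ((f n).divX.continuous.ext_on (dense_compl_singleton 0) hcont fun v hv => ?_) w
  have hf0 : (f n).coeff 0 = 0 := by
    rw [coeff_zero_eq_eval_zero, ← factorial_mul_coeff_egf, h.apply_zero, PowerSeries.coeff_one,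
      if_neg hn, mul_zero]
  have h1 := congrArg (eval v) (divX_mul_X_add (f n))
  have h2 := h.mul_coeff v n
  rw [AddMonoidHom.id_apply] at h2
  simp only [hf0, map_zero, add_zero, eval_mul, eval_X, ← factorial_mul_coeff_egf] at h1
  have hv' : v ≠ 0 := hv
  apply mul_right_cancel₀ hv'
  rw [h1]
  field_simp
  linear_combination h2

theorem IsPowerFamily.coeff_egf_shifted {f : ℕ → ℝ[X]} {H : PowerSeries ℝ}
    (h : IsPowerFamily (AddMonoidHom.id ℝ) H (egf f)) (hf0 : f 0 = 1) (a y : ℝ) (n : ℕ) :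
    PowerSeries.coeff n (egf (shifted f a) y) =
      lagrangeCoeff (AddMonoidHom.id ℝ) H (egf f) a n y := by
  rw [egf, PowerSeries.coeff_mk, shifted, lagrangeCoeff]
  split_ifs with hn
  · simp [hn, egf, hf0]
  · simp only [eval_mul, eval_X, eval_comp, eval_add, eval_C, AddMonoidHom.id_apply,
      h.eval_divX hn, nsmul_eq_mul, mul_comm a]
    field_simp

theorem IsBinomialType.shifted {f : ℕ → ℝ[X]} (hf : IsBinomialType f) (hf0 : f 0 = 1) (a : ℝ) :
    IsBinomialType (shifted f a) := by
  obtain ⟨H, h⟩ := hf.exists_isPowerFamily hf0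
  refine isBinomialType_iff.2 fun x y => ?_
  ext n
  rw [PowerSeries.coeff_mul, Finset.Nat.sum_antidiagonal_eq_sum_range_succ_mk]
  simp only [h.coeff_egf_shifted hf0]
  exact h.lagrangeCoeff_add a x y n

/-! ### Powers of the solution of v = u(t v^r) -/

theorem isPowerFamily_zpow (U : (PowerSeries ℝ)ˣ) :
    IsPowerFamily (Int.castAddHom ℝ) (PowerSeries.derivative ℝ (U : PowerSeries ℝ) * ↑U⁻¹)
      fun z : ℤ => ((U ^ z : (PowerSeries ℝ)ˣ) : PowerSeries ℝ) where
  apply_zero := by simp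
  apply_add v w := by simp [zpow_add]
  derivative w := by
    have hU : (U : PowerSeries ℝ) * ↑U⁻¹ = 1 := U.mul_inv
    induction w using Int.induction_on with
    | zero => simp
    | succ n ih =>
      rw [zpow_add_one, Units.val_mul, Derivation.leibniz, ih]
      simp only [smul_eq_mul, Int.coe_castAddHom, Int.cast_one, map_add, map_one]
      linear_combination (-(((U ^ (n : ℤ) : (PowerSeries ℝ)ˣ) : PowerSeries ℝ) *
        PowerSeries.derivative ℝ (U : PowerSeries ℝ))) * hU
    | pred n ih =>
      have hz : ((U ^ (-n : ℤ) : (PowerSeries ℝ)ˣ) : PowerSeries ℝ) =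
          ((U ^ (-n - 1 : ℤ) : (PowerSeries ℝ)ˣ) : PowerSeries ℝ) * U := by
        rw [← Units.val_mul, zpow_sub_one, inv_mul_cancel_right]
      rw [hz, Derivation.leibniz] at ih
      simp only [smul_eq_mul, Int.coe_castAddHom, Int.cast_one, map_sub, map_one] at ih ⊢
      apply mul_right_cancel₀ U.ne_zero
      linear_combination ih + (((U ^ (-n - 1 : ℤ) : (PowerSeries ℝ)ˣ) : PowerSeries ℝ) *
        PowerSeries.derivative ℝ (U : PowerSeries ℝ)) * hU

/-- The series with coefficients `j / (r m + j) * [t ^ m] u ^ (r m + j)`, which is the `j`-th power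
of the solution `v` of `v (t) = u (t * v (t) ^ r)`. -/
noncomputable def fussSeries (u : PowerSeries ℝ) (r j : ℕ) : PowerSeries ℝ :=
  PowerSeries.mk fun m => (if r * m + j = 0 then 1 else (j : ℝ) / ((r * m + j : ℕ) : ℝ)) *
    PowerSeries.coeff m (u ^ (r * m + j))

/-- Reading 0 / 0 as 1 is what produces the constant term here. -/
theorem fussSeries_zero_right (u : PowerSeries ℝ) (r : ℕ) : fussSeries u r 0 = 1 := by
  ext m
  rw [fussSeries, PowerSeries.coeff_mk]
  split_ifs with h
  · rw [h, pow_zero, one_mul]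
  · have : m ≠ 0 := by rintro rfl; simp at h
    simp [PowerSeries.coeff_one, this]

theorem fussSeries_zero_left (u : PowerSeries ℝ) (j : ℕ) : fussSeries u 0 j = u ^ j := by
  rcases eq_or_ne j 0 with rfl | hj
  · rw [fussSeries_zero_right, pow_zero]
  · ext m
    simp [fussSeries, hj]

theorem fussSeries_eq_zero {u : PowerSeries ℝ} (hu : PowerSeries.constantCoeff u = 0) {r j : ℕ}
    (hr : r ≠ 0) (hj : j ≠ 0) : fussSeries u r j = 0 := by
  ext m
  have h1 : PowerSeries.X ^ (r * m + j) ∣ u ^ (r * m + j) :=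
    pow_dvd_pow_of_dvd (PowerSeries.X_dvd_iff.2 hu) _
  have h2 : m < r * m + j := by nlinarith [Nat.pos_of_ne_zero hr, Nat.pos_of_ne_zero hj]
  rw [fussSeries, PowerSeries.coeff_mk, PowerSeries.X_pow_dvd_iff.1 h1 m h2, mul_zero, map_zero]

theorem coeff_fussSeries_of_unit (U : (PowerSeries ℝ)ˣ) (r : ℕ) {j : ℕ} (hj : j ≠ 0) (m : ℕ) :
    PowerSeries.coeff m (fussSeries U r j) =
      lagrangeCoeff (Int.castAddHom ℝ) (PowerSeries.derivative ℝ (U : PowerSeries ℝ) * ↑U⁻¹)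
        (fun z : ℤ => ((U ^ z : (PowerSeries ℝ)ˣ) : PowerSeries ℝ)) r m j := by
  have h := (isPowerFamily_zpow U).mul_coeff (j + m • (r : ℤ)) m
  have e : (j + m • (r : ℤ) : ℤ) = ((r * m + j : ℕ) : ℤ) := by push_cast; ring
  rw [fussSeries, PowerSeries.coeff_mk, lagrangeCoeff, if_neg (by omega)]
  split_ifs with hm
  · subst hm
    simp [hj]
  · rw [e] at h ⊢
    have hT : ((r * m + j : ℕ) : ℝ) ≠ 0 := by positivity
    simp only [Int.coe_castAddHom, Int.cast_natCast, zpow_natCast, Units.val_pow_eq_pow_val] at h ⊢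
    field_simp
    linear_combination h

theorem fussSeries_add_of_unit (U : (PowerSeries ℝ)ˣ) (r i j : ℕ) :
    fussSeries U r (i + j) = fussSeries U r i * fussSeries U r j := by
  rcases eq_or_ne i 0 with rfl | hi
  · simp [fussSeries_zero_right]
  rcases eq_or_ne j 0 with rfl | hj
  · simp [fussSeries_zero_right]
  ext m
  rw [PowerSeries.coeff_mul, Finset.Nat.sum_antidiagonal_eq_sum_range_succ_mk]
  simp only [coeff_fussSeries_of_unit U r hi, coeff_fussSeries_of_unit U r hj,
    coeff_fussSeries_of_unit U r (show i + j ≠ 0 by omega), Nat.cast_add]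
  exact (isPowerFamily_zpow U).lagrangeCoeff_add _ _ _ m

theorem fussSeries_pow (u : PowerSeries ℝ) (r j k : ℕ) :
    fussSeries u r j ^ k = fussSeries u r (j * k) := by
  rcases eq_or_ne r 0 with rfl | hr
  · simp only [fussSeries_zero_left, pow_mul]
  rcases eq_or_ne j 0 with rfl | hj
  · simp [fussSeries_zero_right]
  rcases eq_or_ne k 0 with rfl | hk
  · simp [fussSeries_zero_right]
  -- Inversion needs negative powers of u, hence u(0) ≠ 0. Otherwise, as r ≥ 1, u^(rm+j) has order
  -- above m and both sides vanish.
  by_cases hu : PowerSeries.constantCoeff u = 0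
  · rw [fussSeries_eq_zero hu hr hj, fussSeries_eq_zero hu hr (mul_ne_zero hj hk), zero_pow hk]
  · obtain ⟨U, rfl⟩ := PowerSeries.isUnit_iff_constantCoeff.2 (isUnit_iff_ne_zero.2 hu)
    clear hk hu
    induction k with
    | zero => simp [fussSeries_zero_right]
    | succ k ih => rw [pow_succ, ih, mul_add_one, fussSeries_add_of_unit]

/-! ### From power series to Bell polynomials -/

theorem satisfiesBell_of_powerSeries {Y : ℕ → ℕ → ℝ} (V : PowerSeries ℝ)
    (hY : ∀ n k, 1 ≤ k → k ≤ n → Y n k = n ! / k ! * PowerSeries.coeff (n - k) (V ^ k)) :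
    SatisfiesBell Y := by
  intro n k hk hkn
  have hV : (PowerSeries.mk fun m => if m = 0 then 0 else Y m 1 / (m ! : ℝ)) =
      PowerSeries.X * V := by
    ext m
    cases m with
    | zero => simp
    | succ m =>
      rw [PowerSeries.coeff_mk, if_neg m.succ_ne_zero, PowerSeries.coeff_succ_X_mul,
        hY _ 1 le_rfl (by omega)]
      simp only [Nat.factorial_one, Nat.cast_one, div_one, Nat.add_sub_cancel, pow_one]
      field_simp
  rw [partialBell, hV, hY n k hk hkn, mul_pow, PowerSeries.coeff_C_mul,
    PowerSeries.coeff_X_pow_mul', if_pos hkn]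
  ring

theorem satisfiesBell_of_fussSeries {Y : ℕ → ℕ → ℝ} (u : PowerSeries ℝ) (r s : ℕ)
    (hY : ∀ n k, 1 ≤ k → k ≤ n → Y n k = n ! / k ! * (bellRatio r s n k *
      PowerSeries.coeff (n - k) (u ^ bellT r s n k))) : SatisfiesBell Y := by
  refine satisfiesBell_of_powerSeries (fussSeries u r s) fun n k hk hkn => ?_
  rw [hY n k hk hkn, fussSeries_pow, fussSeries, PowerSeries.coeff_mk, bellRatio, bellT]
  push_cast
  rfl

/-! ### Derivatives of the generating function -/

/-- The generating function of the derivatives at `0`, which is the `h` in `egf f y = exp (y h)`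
if `f` is of binomial type. -/
noncomputable def egfDeriv (f : ℕ → ℝ[X]) : PowerSeries ℝ :=
  PowerSeries.mk fun n => (derivative (f n)).eval 0 / (n ! : ℝ)

theorem hasDerivAt_coeff_mul (S : PowerSeries ℝ) {P : ℝ → PowerSeries ℝ} {P' : PowerSeries ℝ}
    {y : ℝ} (hP : ∀ n, HasDerivAt (fun y => PowerSeries.coeff n (P y)) (PowerSeries.coeff n P') y)
    (n : ℕ) :
    HasDerivAt (fun y => PowerSeries.coeff n (S * P y)) (PowerSeries.coeff n (S * P')) y := by
  simp only [PowerSeries.coeff_mul]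
  exact HasDerivAt.fun_sum fun p _ => (hP _).const_mul _

theorem IsBinomialType.hasDerivAt_coeff_egf {f : ℕ → ℝ[X]} (hf : IsBinomialType f)
    (S : PowerSeries ℝ) (n : ℕ) (y : ℝ) :
    HasDerivAt (fun y => PowerSeries.coeff n (S * egf f y))
      (PowerSeries.coeff n (S * (egfDeriv f * egf f y))) y := by
  refine hasDerivAt_coeff_mul S (fun n => ?_) n
  have h0 : ∀ m, HasDerivAt (fun z => PowerSeries.coeff m (egf f z))
      (PowerSeries.coeff m (egfDeriv f)) 0 := by
    intro m
    simp only [egf, egfDeriv, PowerSeries.coeff_mk]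
    exact ((f m).hasDerivAt 0).div_const _
  -- The derivative at 0 is carried to y by F(y + z) = F(y) F(z).
  have h1 := hasDerivAt_coeff_mul (egf f y) h0 n
  rw [← sub_self y] at h1
  have h2 := h1.comp_sub_const y y
  simp only [← isBinomialType_iff.1 hf, add_sub_cancel] at h2
  rwa [mul_comm]

theorem IsBinomialType.iteratedDeriv_exp_mul_coeff_egf {f : ℕ → ℝ[X]} (hf : IsBinomialType f)
    (α w : ℝ) (n T : ℕ) (S : PowerSeries ℝ) :
    iteratedDeriv T (fun z => Real.exp (α * z) * PowerSeries.coeff n (S * egf f (w + z))) =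
      fun z => Real.exp (α * z) * PowerSeries.coeff n
        ((PowerSeries.C α + egfDeriv f) ^ T * S * egf f (w + z)) := by
  -- Each differentiation replaces S by (α + h) S.
  induction T generalizing S with
  | zero => simp
  | succ T ih =>
    rw [iteratedDeriv_succ', pow_succ, mul_assoc _ _ S, ← ih]
    congr 1
    ext z
    have h1 := (hf.hasDerivAt_coeff_egf S n (w + z)).comp_const_add w z
    have h2 := ((hasDerivAt_id z).const_mul α).exp
    simp only [id, mul_one] at h2
    rw [(h2.fun_mul h1).deriv, add_mul, add_mul, mul_assoc (PowerSeries.C α), map_add,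
      PowerSeries.coeff_C_mul, mul_left_comm S, mul_assoc (egfDeriv f)]
    ring

theorem IsBinomialType.iteratedDeriv_exp_mul_eval {f : ℕ → ℝ[X]} (hf : IsBinomialType f)
    (α w : ℝ) (n T : ℕ) :
    iteratedDeriv T (fun z => Real.exp (α * z) * (f n).eval (w + z)) 0 =
      n ! * PowerSeries.coeff n ((PowerSeries.C α + egfDeriv f) ^ T * egf f w) := by
  have h := congrFun (hf.iteratedDeriv_exp_mul_coeff_egf α w n T (PowerSeries.C (n ! : ℝ))) 0
  simp only [PowerSeries.coeff_C_mul, factorial_mul_coeff_egf] at h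
  rw [h, mul_right_comm, mul_comm, mul_comm _ (PowerSeries.C (n ! : ℝ)), PowerSeries.coeff_C_mul]
  simp

theorem IsBinomialType.egf_nat_mul {f : ℕ → ℝ[X]} (hf : IsBinomialType f) (hf0 : f 0 = 1)
    (x : ℝ) (T : ℕ) : egf f (T * x) = egf f x ^ T := by
  induction T with
  | zero => simp [hf.egf_zero hf0]
  | succ T ih => rw [Nat.cast_succ, add_one_mul, isBinomialType_iff.1 hf, ih, pow_succ]

theorem theorem1 (f : ℕ → ℝ[X]) (hf : IsBinomialType f) (hf0 : f 0 = 1) (a x α : ℝ) :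
    (∀ r s : ℕ, 1 ≤ r + s →
      SatisfiesBell (bellY f a x α r s) ∧ SatisfiesBell (bellYAlt f a x r s)) ∧
    SatisfiesBell (bellYZero f a x) := by
  have hq := hf.shifted hf0 a
  have hq0 : shifted f a 0 = 1 := if_pos rfl
  refine ⟨fun r s _ => ⟨?_, ?_⟩, ?_⟩
  · refine satisfiesBell_of_fussSeries
      ((PowerSeries.C α + egfDeriv (shifted f a)) * egf (shifted f a) x) r s fun n k _ hkn => ?_
    rw [bellY, hq.iteratedDeriv_exp_mul_eval, hq.egf_nat_mul hq0, ← mul_pow,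
      Nat.cast_choose ℝ hkn]
    field_simp
  -- The zeroth polynomial is constant, so h = t η. The factor t^T of h^T lowers the index T + n - k
  -- to n - k, leaving u = η Q(x).
  · obtain ⟨η, hη⟩ : PowerSeries.X ∣ egfDeriv (shifted f a) := by
      rw [PowerSeries.X_dvd_iff]
      simp [egfDeriv, hq0]
    refine satisfiesBell_of_fussSeries (η * egf (shifted f a) x) r s fun n k _ _ => ?_
    have h := hq.iteratedDeriv_exp_mul_eval 0 (bellT r s n k * x) (bellT r s n k + (n - k))
      (bellT r s n k)
    simp only [zero_mul, Real.exp_zero, one_mul, map_zero, zero_add, hη, hq.egf_nat_mul hq0,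
      mul_pow, mul_assoc, PowerSeries.coeff_X_pow_mul', Nat.le_add_right, if_true,
      Nat.add_sub_cancel_left] at h
    rw [bellYAlt, h, mul_pow]
    field_simp
  · refine satisfiesBell_of_powerSeries (egf (shifted f a) x) fun n k _ hkn => ?_
    rw [bellYZero, ← hq.egf_nat_mul hq0, ← factorial_mul_coeff_egf, Nat.cast_choose ℝ hkn]
    field_simp
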